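/- Let $\Delta^3=\{x\in\mathbb{R}^4 : x_i\ge 0,\ \sum_{i} x_i=1\}$ and $\operatorname{int}\Delta^3=\{x\in\Delta^3 : x_i>0 \text{ for all } i\}$. Let $A\in\mathbb{R}^{4\times 4}$ be skew-symmetric, and consider the replicator dynamics $$\dot x_i(t)=x_i(t)\,(Ax(t))_i,\qquad i=1,2,3,4. \tag{$*$}$$ Assume that $(*)$ is permanent, i.e. for every $x(0)\in\operatorname{int}\Delta^3$ there is $\varepsilon>0$ such that $\liminf_{t\to\infty}x_i(t)\ge\varepsilon$ for all $i$. Let $K=\ker A\cap\operatorname{int}\Delta^3$ be the set of interior equilibria. Then every point of $\operatorname{int}\Delta^3\setminus K$ belongs to a periodic orbit of $(*)$, that is, to the image of a nonconstant periodic solution $x:\mathbb{R}\to\mathbb{R}^4$ of $(*)$. Moreover, every such periodic orbit $\gamma$ is Lyapunov stable: for every $\varepsilon>0$ there is an open neighborhood $U$ of $\gamma$ in $\operatorname{int}\Delta^3$ such that every solution of $(*)$ with $x(0)\in U$ satisfies $\operatorname{dist}(x(t),\gamma)<\varepsilon$ for all $t\ge 0$. -/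

import Mathlib

namespace Replicator

open Matrix

/-- The relative interior of the standard simplex `Δ³ ⊆ ℝ⁴`: strictly positive vectors whose
coordinates sum to one. -/
def intSimplex : Set (EuclideanSpace ℝ (Fin 4)) :=
  {x | (∀ i, 0 < x i) ∧ ∑ i, x i = 1}

/-- The set `K` of interior equilibria: the null space of `A` intersected with `int Δ³`. -/
def interiorEquilibria (A : Matrix (Fin 4) (Fin 4) ℝ) : Set (EuclideanSpace ℝ (Fin 4)) :=
  {x | A *ᵥ x.ofLp = 0} ∩ intSimplex

/-- The replicator vector field `x ↦ (xᵢ (A x)ᵢ)ᵢ` of a skew-symmetric payoff matrix `A`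
(for which the mean payoff `xᵀ A x` vanishes). -/
noncomputable def field (A : Matrix (Fin 4) (Fin 4) ℝ) (x : EuclideanSpace ℝ (Fin 4)) :
    EuclideanSpace ℝ (Fin 4) :=
  WithLp.toLp 2 (fun i => x i * (A *ᵥ x.ofLp) i)

/-- `x` solves the replicator equation `ẋᵢ = xᵢ (A x)ᵢ` for all times `t ≥ 0`. -/
def IsForwardTrajectory (A : Matrix (Fin 4) (Fin 4) ℝ) (x : ℝ → EuclideanSpace ℝ (Fin 4)) :
    Prop :=
  IsIntegralCurveOn x (fun _ => field A) (Set.Ici 0)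

/-- Permanence: for every initial condition in `int Δ³` there is `ε > 0` such that each coordinate
of the trajectory has inferior limit at least `ε` as `t → ∞`. -/
def IsPermanent (A : Matrix (Fin 4) (Fin 4) ℝ) : Prop :=
  ∀ p ∈ intSimplex, ∃ ε : ℝ, 0 < ε ∧
    ∀ x : ℝ → EuclideanSpace ℝ (Fin 4), IsForwardTrajectory A x → x 0 = p →
      ∀ i, ε ≤ Filter.liminf (fun t => x t i) Filter.atTop

/-- `γ` is a periodic orbit: the image of a nonconstant periodic solution of the replicator
equation defined for all times. -/
def IsPeriodicOrbit (A : Matrix (Fin 4) (Fin 4) ℝ) (γ : Set (EuclideanSpace ℝ (Fin 4))) : Prop :=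
  ∃ (x : ℝ → EuclideanSpace ℝ (Fin 4)) (T : ℝ),
    IsIntegralCurve x (fun _ => field A) ∧ 0 < T ∧ Function.Periodic x T ∧
      (∃ s t, x s ≠ x t) ∧ γ = Set.range x

/-- Lyapunov (orbital) stability of the set `γ` for the dynamics on `int Δ³`: for every `ε > 0`
there is an open neighborhood `U` of `γ` such that every trajectory starting in `U ∩ int Δ³` stays
at distance less than `ε` from `γ` for all `t ≥ 0`. -/
def IsLyapunovStable (A : Matrix (Fin 4) (Fin 4) ℝ) (γ : Set (EuclideanSpace ℝ (Fin 4))) : Prop :=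
  ∀ ε : ℝ, 0 < ε → ∃ U : Set (EuclideanSpace ℝ (Fin 4)), IsOpen U ∧ γ ⊆ U ∧
    ∀ y : ℝ → EuclideanSpace ℝ (Fin 4), IsForwardTrajectory A y → y 0 ∈ U ∩ intSimplex →
      ∀ t : ℝ, 0 ≤ t → Metric.infDist (y t) γ < ε

end Replicator

namespace Replicator

/-! Time averages of a permanent trajectory accumulate at a positive kernel vector q
(`IsPermanent.exists_pos_kernel`). So A is singular and skew: its Pfaffian vanishes, and if A ≠ 0
then A = a(α ∧ β) (`exists_isWedge`).

In coordinates y = log x the equation is y' = A exp(y), so y stays in a plane parallel to span(α,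
β). There it is a planar Hamiltonian system whose convex energy Σ exp(y_k) is conserved, with value
1. Since α and β annihilate q, Σ q_k y_k is also conserved; with y ≤ 0 this bounds the orbit. Off
equilibria the plane contains a point c of energy below 1. By convexity every ray from c meets the
level curve at most once, and the orbit turns around c with angular speed bounded below. Hence it
sweeps the whole level curve and returns to its start (`IsWedge.exists_eq_of_invariants_eq`).

A periodic orbit is thus a full joint level set of conserved quantities, and compactness of nearby
levels gives stability (`IsWedge.isLyapunovStable`). -/

open Matrix Set Filter Topology

/-! ### Global flows of bounded Lipschitz fields -/

section GlobalSolution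

open scoped NNReal

variable {E : Type*} [NormedAddCommGroup E] [NormedSpace ℝ E] [CompleteSpace E]

/-- A bounded Lipschitz autonomous vector field has a global solution through every point. -/
theorem exists_global_solution {f : E → E} {K L : ℝ≥0} (hK : LipschitzWith K f)
    (hL : ∀ x, ‖f x‖ ≤ L) (x₀ : E) :
    ∃ y : ℝ → E, y 0 = x₀ ∧ ∀ t, HasDerivAt y (f (y t)) t := by
  have h (n : ℕ) : ∃ α : ℝ → E, α 0 = x₀ ∧
      ∀ t ∈ Ioo (-(n + 1) : ℝ) (n + 1), HasDerivAt α (f (α t)) t := by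
    have h0 : (0 : ℝ) ∈ Icc (-(n + 1) : ℝ) (n + 1) := by
      constructor <;> linarith [(n.cast_nonneg : (0 : ℝ) ≤ n)]
    have hpl : IsPicardLindelof (fun _ => f) (⟨0, h0⟩ : Icc (-(n + 1) : ℝ) (n + 1)) x₀
        (L * (n + 1)) 0 L K :=
      { lipschitzOnWith := fun _ _ => hK.lipschitzOnWith
        continuousOn := fun _ _ => continuousOn_const
        norm_le := fun _ _ x _ => hL x
        mul_max_le := by simp }
    obtain ⟨α, h1, h2⟩ := hpl.exists_eq_forall_mem_Icc_hasDerivWithinAt₀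
    exact ⟨α, h1, fun t ht =>
      (h2 t (Ioo_subset_Icc_self ht)).hasDerivAt (Icc_mem_nhds ht.1 ht.2)⟩
  choose α hα0 hα using h
  have agree (m n : ℕ) (hmn : m ≤ n) : EqOn (α m) (α n) (Ioo (-(m + 1) : ℝ) (m + 1)) := by
    have hmn' : (m : ℝ) ≤ n := by exact_mod_cast hmn
    have hm0 : (0 : ℝ) ≤ m := m.cast_nonneg
    refine ODE_solution_unique_of_mem_Ioo (v := fun _ => f) (s := fun _ => univ) (K := K)
      (t₀ := 0) (fun _ _ => hK.lipschitzOnWith) ⟨by linarith, by linarith⟩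
      (fun t ht => ⟨hα m t ht, trivial⟩)
      (fun t ht => ⟨hα n t ⟨by linarith [ht.1], by linarith [ht.2]⟩, trivial⟩) ?_
    rw [hα0, hα0]
  -- Near t the glued curve agrees with the single solution of index ⌈|t|⌉₊ + 1, which gives
  -- differentiability where the ceiling jumps.
  refine ⟨fun t => α ⌈|t|⌉₊ t, by simp [hα0], fun t => ?_⟩
  have mem (s : ℝ) : s ∈ Ioo (-((⌈|s|⌉₊ : ℕ) + 1) : ℝ) ((⌈|s|⌉₊ : ℕ) + 1) := by
    have := Nat.le_ceil |s|
    have := abs_le.1 this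
    constructor <;> linarith [this.1, this.2]
  have key (s : ℝ) (hs : |s| < |t| + 1) : α ⌈|s|⌉₊ s = α (⌈|t|⌉₊ + 1) s := by
    refine agree _ _ ?_ (mem s)
    rw [Nat.ceil_le]
    push_cast
    linarith [Nat.le_ceil |t|]
  have hev : (fun s => α ⌈|s|⌉₊ s) =ᶠ[𝓝 t] α (⌈|t|⌉₊ + 1) := by
    have : ∀ᶠ s in 𝓝 t, |s| < |t| + 1 :=
      (continuous_abs.tendsto t).eventually_lt_const (by linarith)
    filter_upwards [this] with s hs using key s hs
  have hd := hα (⌈|t|⌉₊ + 1) t (by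
    have := mem t
    push_cast
    constructor <;> linarith [this.1, this.2])
  rw [← key t (by linarith)] at hd
  exact hd.congr_of_eventuallyEq hev

end GlobalSolution

/-! ### Logarithmic coordinates and global orbits -/

/-- The logarithmic form of the replicator field, cut off so as to be bounded. -/
noncomputable def cutoffField (A : Matrix (Fin 4) (Fin 4) ℝ) (y : Fin 4 → ℝ) : Fin 4 → ℝ :=
  A *ᵥ fun j => Real.exp (min (y j) 0)

theorem abs_exp_min_sub_le (a b : ℝ) :
    |Real.exp (min a 0) - Real.exp (min b 0)| ≤ |a - b| := by
  wlog h : b ≤ a generalizing a b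
  · rw [abs_sub_comm, abs_sub_comm a]
    exact this b a (le_of_not_ge h)
  have hm : min b 0 ≤ min a 0 := min_le_min_right 0 h
  rw [abs_of_nonneg (by linarith [Real.exp_le_exp.2 hm]), abs_of_nonneg (by linarith)]
  have h1 : Real.exp (min a 0) ≤ 1 := Real.exp_le_one_iff.2 (min_le_right _ _)
  have h2 : min a 0 - min b 0 ≤ a - b := by
    rcases le_total a 0 with ha | ha <;> rcases le_total b 0 with hb | hb <;>
      grind
  have h3 : Real.exp (min b 0) =
      Real.exp (min a 0) * Real.exp (min b 0 - min a 0) := by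
    rw [← Real.exp_add]; ring_nf
  have h4 := Real.add_one_le_exp (min b 0 - min a 0)
  have h5 := Real.exp_pos (min a 0)
  nlinarith

theorem exists_lipschitzWith_cutoffField (A : Matrix (Fin 4) (Fin 4) ℝ) :
    ∃ K, LipschitzWith K (cutoffField A) ∧ ∀ y, ‖cutoffField A y‖ ≤ K := by
  let T := LinearMap.toContinuousLinearMap (Matrix.mulVecLin A)
  have hT (y : Fin 4 → ℝ) : cutoffField A y = T fun j => Real.exp (min (y j) 0) := rfl
  refine ⟨‖T‖₊, ?_, fun y => ?_⟩
  · refine LipschitzWith.of_dist_le_mul fun x y => ?_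
    rw [hT, hT]
    refine (T.lipschitz.dist_le_mul _ _).trans ?_
    gcongr
    refine (dist_pi_le_iff dist_nonneg).2 fun j => ?_
    exact (abs_exp_min_sub_le _ _).trans (dist_le_pi_dist x y j)
  · rw [hT]
    refine (T.le_opNorm _).trans (mul_le_of_le_one_right (norm_nonneg _) ?_)
    refine (pi_norm_le_iff_of_nonneg zero_le_one).2 fun j => ?_
    rw [Real.norm_eq_abs, abs_of_pos (Real.exp_pos _)]
    exact Real.exp_le_one_iff.2 (min_le_right _ _)

/-- A primitive of `s ↦ exp (min s 0)`. -/
noncomputable def cutoffExp (s : ℝ) : ℝ := if s ≤ 0 then Real.exp s else 1 + s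

theorem hasDerivAt_cutoffExp (s : ℝ) : HasDerivAt cutoffExp (Real.exp (min s 0)) s := by
  have hl : EqOn cutoffExp Real.exp (Iic 0) := fun s hs => if_pos hs
  have hr : EqOn cutoffExp (fun s => 1 + s) (Ici 0) := fun s hs => by
    rcases (mem_Ici.1 hs).eq_or_lt with rfl | h
    · simp [cutoffExp]
    · exact if_neg (not_le.2 h)
  rcases lt_trichotomy s 0 with h | rfl | h
  · rw [min_eq_left h.le]
    exact (Real.hasDerivAt_exp s).congr_of_eventuallyEq
      (hl.eventuallyEq_of_mem (Iic_mem_nhds h))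
  · have h1 : HasDerivWithinAt cutoffExp 1 (Iic 0) 0 := by
      have := (Real.hasDerivAt_exp 0).hasDerivWithinAt (s := Iic 0)
      rw [Real.exp_zero] at this
      exact this.congr hl (hl (mem_Iic.2 le_rfl))
    have h2 : HasDerivWithinAt cutoffExp 1 (Ici 0) 0 :=
      ((hasDerivAt_id (0 : ℝ)).const_add 1).hasDerivWithinAt.congr hr (hr (mem_Ici.2 le_rfl))
    have := h1.union h2
    rw [Iic_union_Ici, hasDerivWithinAt_univ] at this
    simpa using this
  · rw [min_eq_right h.le, Real.exp_zero]
    exact ((hasDerivAt_id s).const_add 1).congr_of_eventuallyEq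
      (hr.eventuallyEq_of_mem (Ici_mem_nhds h))

theorem cutoffExp_pos (s : ℝ) : 0 < cutoffExp s := by
  unfold cutoffExp
  split_ifs with h
  · exact Real.exp_pos s
  · linarith

theorem dotProduct_mulVec_self_of_skew {A : Matrix (Fin 4) (Fin 4) ℝ} (hskew : A.transpose = -A)
    (v : Fin 4 → ℝ) : v ⬝ᵥ A *ᵥ v = 0 := by
  have h : v ⬝ᵥ A *ᵥ v = -(v ⬝ᵥ A *ᵥ v) := by
    conv_lhs => rw [dotProduct_comm, ← vecMul_transpose, ← dotProduct_mulVec, hskew]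
    simp [neg_mulVec]
  linarith

/-- `y` solves the replicator equation in logarithmic coordinates, on the unit simplex. -/
structure IsLogOrbit (A : Matrix (Fin 4) (Fin 4) ℝ) (y : ℝ → Fin 4 → ℝ) : Prop where
  hasDerivAt : ∀ t, HasDerivAt y (A *ᵥ fun j => Real.exp (y t j)) t
  sum_exp : ∀ t, ∑ i, Real.exp (y t i) = 1

/-- The point with given logarithmic coordinates. -/
noncomputable def ofLog (y : Fin 4 → ℝ) : EuclideanSpace ℝ (Fin 4) :=
  WithLp.toLp 2 fun i => Real.exp (y i)

@[simp] theorem ofLog_apply (y : Fin 4 → ℝ) (i : Fin 4) : ofLog y i = Real.exp (y i) := rfl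

theorem neg_of_sum_exp_eq_one {y : Fin 4 → ℝ} (h : ∑ i, Real.exp (y i) = 1) (i : Fin 4) :
    y i < 0 := by
  have hlt : Real.exp (y i) < ∑ i, Real.exp (y i) :=
    Finset.single_lt_sum (j := i + 1) (by simp) (Finset.mem_univ _) (Finset.mem_univ _)
      (Real.exp_pos _) fun k _ _ => (Real.exp_pos _).le
  rw [h] at hlt
  exact Real.exp_lt_one_iff.1 hlt

theorem ofLog_mem_intSimplex {y : Fin 4 → ℝ} (h : ∑ i, Real.exp (y i) = 1) :
    ofLog y ∈ intSimplex := ⟨fun _ => Real.exp_pos _, h⟩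

theorem exists_ofLog_eq {p : EuclideanSpace ℝ (Fin 4)} (hp : p ∈ intSimplex) :
    ∃ y : Fin 4 → ℝ, ofLog y = p ∧ ∑ i, Real.exp (y i) = 1 := by
  have h (i : Fin 4) : Real.exp (Real.log (p i)) = p i := Real.exp_log (hp.1 i)
  refine ⟨fun i => Real.log (p i), ?_, ?_⟩
  · ext i
    simp [h]
  · simp only [h]
    exact hp.2

variable {A : Matrix (Fin 4) (Fin 4) ℝ} {y : ℝ → Fin 4 → ℝ}

theorem IsLogOrbit.hasDerivAt_cutoff (h : IsLogOrbit A y) (t : ℝ) :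
    HasDerivAt y (cutoffField A (y t)) t := by
  have : (fun j => Real.exp (min (y t j) 0)) = fun j => Real.exp (y t j) := by
    funext j
    rw [min_eq_left (neg_of_sum_exp_eq_one (h.sum_exp t) j).le]
  rw [cutoffField, this]
  exact h.hasDerivAt t

/-- Skew-symmetry makes Σ `cutoffExp` (y_i) constant along the cut-off flow. As `cutoffExp` is
positive, and exceeds 1 on positive arguments, the value 1 forces y ≤ 0, where the cutoff is
inactive. -/
theorem exists_isLogOrbit (hskew : A.transpose = -A) {y₀ : Fin 4 → ℝ}
    (h₀ : ∑ i, Real.exp (y₀ i) = 1) : ∃ y, y 0 = y₀ ∧ IsLogOrbit A y := by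
  obtain ⟨K, hK, hL⟩ := exists_lipschitzWith_cutoffField A
  obtain ⟨y, hy0, hy⟩ := exists_global_solution hK hL y₀
  have hd (t : ℝ) : HasDerivAt (fun t => ∑ i, cutoffExp (y t i)) 0 t := by
    have h1 : HasDerivAt (fun t => ∑ i, cutoffExp (y t i))
        (∑ i, Real.exp (min (y t i) 0) * cutoffField A (y t) i) t :=
      HasDerivAt.fun_sum fun i _ =>
        HasDerivAt.comp (h₂ := cutoffExp) (h := fun t => y t i) t (hasDerivAt_cutoffExp (y t i))
          (hasDerivAt_pi.1 (hy t) i)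
    convert! h1 using 1
    exact (dotProduct_mulVec_self_of_skew hskew _).symm
  have hc (t : ℝ) : ∑ i, cutoffExp (y t i) = 1 := by
    rw [is_const_of_deriv_eq_zero (fun t => (hd t).differentiableAt) (fun t => (hd t).deriv) t 0,
      hy0, ← h₀]
    exact Finset.sum_congr rfl fun i _ => if_pos (neg_of_sum_exp_eq_one h₀ i).le
  have hneg (t : ℝ) (i : Fin 4) : y t i ≤ 0 := by
    by_contra! hpos
    have := Finset.single_le_sum (f := fun i => cutoffExp (y t i))
      (fun i _ => (cutoffExp_pos _).le) (Finset.mem_univ i)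
    rw [hc] at this
    simp only [cutoffExp, if_neg (not_le.2 hpos)] at this
    linarith
  refine ⟨y, hy0, ⟨fun t => ?_, fun t => ?_⟩⟩
  · have := hy t
    simp only [cutoffField, min_eq_left (hneg t _)] at this
    exact this
  · rw [← hc t]
    exact Finset.sum_congr rfl fun i _ => (if_pos (hneg t i)).symm

theorem IsLogOrbit.periodic (h : IsLogOrbit A y) {T : ℝ} (hT : y T = y 0) :
    Function.Periodic y T := by
  obtain ⟨K, hK, -⟩ := exists_lipschitzWith_cutoffField A
  have : (fun t => y (t + T)) = y :=
    ODE_solution_unique_univ (v := fun _ => cutoffField A) (s := fun _ => univ) (K := K) (t₀ := 0)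
      (fun _ => hK.lipschitzOnWith)
      (fun t => ⟨HasDerivAt.comp_add_const t T (h.hasDerivAt_cutoff (t + T)), trivial⟩)
      (fun t => ⟨h.hasDerivAt_cutoff t, trivial⟩) (by simpa using hT)
  exact fun t => congrFun this t

theorem IsLogOrbit.isIntegralCurve (h : IsLogOrbit A y) :
    IsIntegralCurve (fun t => ofLog (y t)) (fun _ => field A) := by
  intro t
  have h1 : HasDerivAt (fun t i => Real.exp (y t i))
      (fun i => Real.exp (y t i) * (A *ᵥ fun j => Real.exp (y t j)) i) t :=
    hasDerivAt_pi.2 fun i => (hasDerivAt_pi.1 (h.hasDerivAt t) i).exp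
  exact ((PiLp.continuousLinearEquiv 2 ℝ fun _ : Fin 4 => ℝ).symm.hasFDerivAt).comp_hasDerivAt t h1

theorem contDiff_field (A : Matrix (Fin 4) (Fin 4) ℝ) : ContDiff ℝ 1 (field A) := by
  rw [contDiff_euclidean]
  intro i
  simp only [field, mulVec, dotProduct]
  fun_prop

theorem exists_lipschitzOnWith_field (A : Matrix (Fin 4) (Fin 4) ℝ) (R : ℝ) :
    ∃ K, LipschitzOnWith K (field A) (Metric.closedBall 0 R) :=
  (contDiff_field A).contDiffOn.exists_lipschitzOnWith one_ne_zero
    (convex_closedBall 0 R) (isCompact_closedBall 0 R)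

/-- The quadratic field is only locally Lipschitz, so uniqueness is applied on a ball containing
both curves over [0, t]. -/
theorem IsLogOrbit.eq_of_isForwardTrajectory (h : IsLogOrbit A y)
    {x : ℝ → EuclideanSpace ℝ (Fin 4)} (hx : IsForwardTrajectory A x) (h0 : x 0 = ofLog (y 0))
    {t : ℝ} (ht : 0 ≤ t) : x t = ofLog (y t) := by
  have hxc : ContinuousOn x (Icc 0 t) :=
    (IsIntegralCurveOn.continuousOn hx).mono Icc_subset_Ici_self
  have hyc : ContinuousOn (fun t => ofLog (y t)) (Icc 0 t) :=
    h.isIntegralCurve.continuous.continuousOn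
  obtain ⟨R₁, hR₁⟩ := isCompact_Icc.exists_bound_of_continuousOn hxc
  obtain ⟨R₂, hR₂⟩ := isCompact_Icc.exists_bound_of_continuousOn hyc
  obtain ⟨K, hK⟩ := exists_lipschitzOnWith_field A (max R₁ R₂)
  refine ODE_solution_unique_of_mem_Icc_right (v := fun _ => field A)
    (s := fun _ => Metric.closedBall 0 (max R₁ R₂)) (K := K) (fun _ _ => hK) hxc
    (fun s hs => (hx s hs.1).mono (Ici_subset_Ici.2 hs.1)) (fun s hs => ?_) hyc
    (fun s _ => (h.isIntegralCurve s).hasDerivWithinAt) (fun s hs => ?_) h0 ⟨ht, le_rfl⟩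
  · exact mem_closedBall_zero_iff.2 ((hR₁ s (Ico_subset_Icc_self hs)).trans (le_max_left _ _))
  · exact mem_closedBall_zero_iff.2 ((hR₂ s (Ico_subset_Icc_self hs)).trans (le_max_right _ _))

/-! ### Winding of plane curves -/

/-- A plane curve that turns around the origin with angular velocity bounded away from zero meets
every ray from the origin at some positive time. -/
theorem exists_pos_smul_eq_of_im_div_le {z v : ℝ → ℂ} (hz : ∀ t, HasDerivAt z (v t) t)
    (hv : Continuous v) (hz0 : ∀ t, z t ≠ 0) {c : ℝ} (hc : 0 < c)
    (him : ∀ t, (v t / z t).im ≤ -c) {ζ : ℂ} (hζ : ζ ≠ 0) :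
    ∃ t > 0, ∃ r : ℝ, 0 < r ∧ ζ = r * z t := by
  have hzc : Continuous z := continuous_iff_continuousAt.2 fun t => (hz t).continuousAt
  have hgc : Continuous fun t => v t / z t := hv.div hzc hz0
  -- A continuous logarithm of z / z 0; its imaginary part is the angle turned.
  set g := fun t => ∫ s in (0 : ℝ)..t, v s / z s with hg
  have hgd (t : ℝ) : HasDerivAt g (v t / z t) t :=
    intervalIntegral.integral_hasDerivAt_right (hgc.intervalIntegrable _ _)
      (hgc.stronglyMeasurableAtFilter _ _) hgc.continuousAt
  have hg0 : g 0 = 0 := by simp [hg]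
  have hexp (t : ℝ) : z t = z 0 * Complex.exp (g t) := by
    have hd (t : ℝ) : HasDerivAt (fun t => z t * Complex.exp (-g t)) 0 t := by
      have := (hz t).mul ((hgd t).neg.cexp)
      convert! this using 1
      have := hz0 t
      simp only [Pi.neg_apply]
      field_simp
      ring
    have hcst := is_const_of_deriv_eq_zero (fun t => (hd t).differentiableAt)
      (fun t => (hd t).deriv) t 0
    simp only [hg0, neg_zero, Complex.exp_zero, mul_one] at hcst
    rw [← hcst, mul_assoc, ← Complex.exp_add]
    simp
  have hθd (t : ℝ) : HasDerivAt (fun t => (g t).im) (v t / z t).im t :=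
    (Complex.imCLM.hasFDerivAt).comp_hasDerivAt t (hgd t)
  have hθc : Continuous fun t => (g t).im :=
    continuous_iff_continuousAt.2 fun t => (hθd t).continuousAt
  have hθle (t : ℝ) (ht : 0 ≤ t) : (g t).im ≤ -c * t := by
    have hanti : Antitone fun t => (g t).im + c * t :=
      antitone_of_hasDerivAt_nonpos (fun t => (hθd t).add ((hasDerivAt_id t).const_mul c))
        (fun t => by simpa using by linarith [him t])
    have := hanti ht
    simp only [hg0, Complex.zero_im] at this
    linarith
  have hw : ζ / z 0 ≠ 0 := div_ne_zero hζ (hz0 0)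
  -- Subtracting a full turn makes the target angle strictly negative, so the time found is positive
  -- even when ζ lies on the ray of z 0.
  set φ := (ζ / z 0).arg - 2 * Real.pi with hφ
  have hφ0 : φ < 0 := by linarith [Complex.arg_le_pi (ζ / z 0), Real.pi_pos]
  have hT : 0 ≤ -φ / c := div_nonneg (by linarith) hc.le
  obtain ⟨t, ht, hteq⟩ : ∃ t ∈ Icc 0 (-φ / c), (g t).im = φ := by
    refine intermediate_value_Icc' hT hθc.continuousOn ⟨?_, ?_⟩
    · refine (hθle _ hT).trans_eq ?_
      field_simp
    · simpa [hg0] using hφ0.le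
  refine ⟨t, lt_of_le_of_ne ht.1 ?_, ‖ζ / z 0‖ * Real.exp (-(g t).re), by positivity, ?_⟩
  · rintro rfl
    simp [hg0] at hteq
    exact hφ0.ne hteq.symm
  · have h1 : Complex.exp (g t) = Real.exp (g t).re * Complex.exp ((ζ / z 0).arg * Complex.I) := by
      conv_lhs => rw [← Complex.re_add_im (g t), hteq, hφ, Complex.exp_add]
      rw [Complex.ofReal_exp]
      congr 1
      rw [Complex.exp_eq_exp_iff_exists_int]
      exact ⟨-1, by push_cast; ring⟩
    have h2 := Complex.norm_mul_exp_arg_mul_I (ζ / z 0)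
    have h3 : ((Real.exp (-(g t).re) : ℝ) : ℂ) * (Real.exp (g t).re : ℝ) = 1 := by
      rw [← Complex.ofReal_mul, ← Real.exp_add]; simp
    rw [hexp t, h1]
    calc ζ = z 0 * (ζ / z 0) := by field_simp [hz0 0]
      _ = z 0 * (‖ζ / z 0‖ * Complex.exp ((ζ / z 0).arg * Complex.I)) * 1 := by rw [h2, mul_one]
      _ = _ := by rw [← h3]; push_cast; ring

/-! ### Interior equilibrium from permanence -/

/-- Time averages of a permanent trajectory accumulate at an interior equilibrium. -/
theorem IsPermanent.exists_pos_kernel (hskew : A.transpose = -A) (hperm : IsPermanent A) :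
    ∃ q : Fin 4 → ℝ, (∀ i, 0 < q i) ∧ A *ᵥ q = 0 := by
  have hsum : ∑ i : Fin 4, Real.exp ((fun _ => Real.log (1 / 4)) i) = 1 := by
    rw [Finset.sum_const, Real.exp_log (by norm_num)]
    norm_num
  obtain ⟨y, hy0, hy⟩ := exists_isLogOrbit hskew hsum
  obtain ⟨ε, hε, hlim⟩ := hperm (ofLog (y 0)) (ofLog_mem_intSimplex (hy.sum_exp 0))
  have hlim' := hlim _ (hy.isIntegralCurve.isIntegralCurveOn _) rfl
  have hev : ∀ i, ∀ᶠ t in atTop, ε / 2 < Real.exp (y t i) := fun i =>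
    eventually_lt_of_lt_liminf ((half_lt_self hε).trans_le (hlim' i))
      ⟨0, by simpa using ⟨0, fun t _ => (Real.exp_pos (y t i)).le⟩⟩
  obtain ⟨T, hT⟩ := eventually_atTop.1 (eventually_all.2 hev)
  have hyc : Continuous y := continuous_iff_continuousAt.2 fun t => (hy.hasDerivAt t).continuousAt
  have hec (i : Fin 4) : Continuous fun t => Real.exp (y t i) := by fun_prop
  have hi (i : Fin 4) (a b : ℝ) :
      IntervalIntegrable (fun t => Real.exp (y t i)) MeasureTheory.volume a b :=
    (hec i).intervalIntegrable _ _
  let avg : ℕ → Fin 4 → ℝ := fun n i =>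
    (n + 1 : ℝ)⁻¹ * ∫ t in T..(T + (n + 1)), Real.exp (y t i)
  have hn (n : ℕ) : (0 : ℝ) < n + 1 := by positivity
  have hmem (n : ℕ) : avg n ∈ Icc (fun _ => ε / 2) (fun _ : Fin 4 => (1 : ℝ)) := by
    refine ⟨fun i => ?_, fun i => ?_⟩
    · have := intervalIntegral.integral_mono_on (a := T) (b := T + (n + 1)) (by linarith [hn n])
        intervalIntegrable_const (hi i _ _) (fun t ht => (hT t ht.1 i).le)
      rw [intervalIntegral.integral_const, add_sub_cancel_left, smul_eq_mul] at this
      show ε / 2 ≤ (n + 1 : ℝ)⁻¹ * _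
      rw [le_inv_mul_iff₀ (hn n)]
      exact this
    · have := intervalIntegral.integral_mono_on (a := T) (b := T + (n + 1)) (by linarith [hn n])
        (hi i _ _) intervalIntegrable_const
        (fun t _ => (Real.exp_lt_one_iff.2 (neg_of_sum_exp_eq_one (hy.sum_exp t) i)).le)
      rw [intervalIntegral.integral_const, add_sub_cancel_left, smul_eq_mul] at this
      show (n + 1 : ℝ)⁻¹ * _ ≤ 1
      rw [inv_mul_le_iff₀ (hn n)]
      exact this
  -- A applied to the average is the mean of y', an increment of y over elapsed time. It tends to 0
  -- because y lies between log(ε/2) and 0 after T.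
  have havg (n : ℕ) (i : Fin 4) :
      (A *ᵥ avg n) i = (n + 1 : ℝ)⁻¹ * (y (T + (n + 1)) i - y T i) := by
    have hftc : ∫ t in T..(T + (n + 1)), (A *ᵥ fun j => Real.exp (y t j)) i =
        y (T + (n + 1)) i - y T i := by
      refine intervalIntegral.integral_eq_sub_of_hasDerivAt
        (fun t _ => hasDerivAt_pi.1 (hy.hasDerivAt t) i) ?_
      refine Continuous.intervalIntegrable ?_ _ _
      simp only [mulVec, dotProduct]
      fun_prop
    rw [← hftc]
    simp only [mulVec, dotProduct, avg]
    rw [intervalIntegral.integral_finsetSum fun j _ => (hi j _ _).const_mul _, Finset.mul_sum]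
    refine Finset.sum_congr rfl fun j _ => ?_
    rw [intervalIntegral.integral_const_mul]
    ring
  obtain ⟨q, hq, φ, hφ, hconv⟩ := isCompact_Icc.tendsto_subseq hmem
  refine ⟨q, fun i => (half_pos hε).trans_le (hq.1 i), ?_⟩
  have hAc : Continuous fun v : Fin 4 → ℝ => A *ᵥ v := by fun_prop
  have h1 : Tendsto (fun n => A *ᵥ avg (φ n)) atTop (𝓝 (A *ᵥ q)) := (hAc.tendsto q).comp hconv
  refine tendsto_nhds_unique h1 (tendsto_pi_nhds.2 fun i => ?_)
  have h2 : Tendsto (fun n : ℕ => (n + 1 : ℝ)⁻¹ * |Real.log (ε / 2)|) atTop (𝓝 0) := by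
    have := (tendsto_one_div_add_atTop_nhds_zero_nat (𝕜 := ℝ)).mul_const |Real.log (ε / 2)|
    simpa using this
  refine squeeze_zero_norm (fun n => ?_) (h2.comp hφ.tendsto_atTop)
  rw [havg, norm_mul, Real.norm_of_nonneg (inv_nonneg.2 (hn _).le)]
  refine mul_le_mul_of_nonneg_left ?_ (inv_nonneg.2 (hn _).le)
  have hb (t : ℝ) (ht : T ≤ t) : Real.log (ε / 2) ≤ y t i ∧ y t i ≤ 0 := by
    refine ⟨?_, (neg_of_sum_exp_eq_one (hy.sum_exp t) i).le⟩
    rw [Real.log_le_iff_le_exp (half_pos hε)]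
    exact (hT t ht i).le
  have b1 := hb T le_rfl
  have b2 := hb (T + (φ n + 1)) (by linarith [hn (φ n)])
  rw [Real.norm_eq_abs, abs_of_nonpos (b1.1.trans b1.2)]
  exact abs_le.2 ⟨by linarith, by linarith⟩

/-! ### Rank-two structure and conserved quantities -/

/-- `A` is the multiple `a • (α ∧ β)` of a decomposable bivector, with `α` and `β` normalized in the
coordinates `i` and `j`. -/
structure IsWedge (A : Matrix (Fin 4) (Fin 4) ℝ) (a : ℝ) (α β : Fin 4 → ℝ) (i j : Fin 4) :
    Prop where
  pos : 0 < a
  left_fst : α i = 1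
  left_snd : α j = 0
  right_fst : β i = 0
  right_snd : β j = 1
  apply_eq : ∀ k l, A k l = a * (α k * β l - β k * α l)

/-- A singular skew-symmetric `4 × 4` matrix has vanishing Pfaffian, so it is a multiple of the
wedge of two of its columns. -/
theorem exists_isWedge (hskew : A.transpose = -A) {q : Fin 4 → ℝ} (hq : ∀ i, 0 < q i)
    (hAq : A *ᵥ q = 0) (hA : A ≠ 0) :
    ∃ (a : ℝ) (α β : Fin 4 → ℝ) (i j : Fin 4), IsWedge A a α β i j := by
  have hs (k l : Fin 4) : A k l = -A l k := congrFun (congrFun hskew l) k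
  have hd (k : Fin 4) : A k k = 0 := by linarith [hs k k]
  obtain ⟨i, j, hij⟩ : ∃ i j, 0 < A i j := by
    by_contra! hle
    refine hA (ext fun k l => le_antisymm (hle k l) ?_)
    rw [hs k l]
    simpa using hle l k
  have hrow (k : Fin 4) : A k 0 * q 0 + A k 1 * q 1 + A k 2 * q 2 + A k 3 * q 3 = 0 := by
    simpa [mulVec, dotProduct, Fin.sum_univ_four] using congrFun hAq k
  have hpf : A 0 1 * A 2 3 - A 0 2 * A 1 3 + A 0 3 * A 1 2 = 0 := by
    have h0 := hrow 0
    have h1 := hrow 1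
    have h2 := hrow 2
    rw [hd] at h0 h1 h2
    rw [hs 1 0] at h1
    rw [hs 2 0, hs 2 1] at h2
    have : (A 0 1 * A 2 3 - A 0 2 * A 1 3 + A 0 3 * A 1 2) * q 3 = 0 := by
      linear_combination A 0 1 * h2 - A 0 2 * h1 + A 1 2 * h0
    exact (mul_eq_zero.1 this).resolve_right (hq 3).ne'
  -- The Plücker expression is alternating, so it is 0 or ± the Pfaffian.
  have hplu (i j k l : Fin 4) : A i j * A k l - A i k * A j l + A i l * A j k = 0 := by
    have e1 := hs 1 0
    have e2 := hs 2 0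
    have e3 := hs 3 0
    have e4 := hs 2 1
    have e5 := hs 3 1
    have e6 := hs 3 2
    fin_cases i <;> fin_cases j <;> fin_cases k <;> fin_cases l <;>
      simp only [Fin.zero_eta, Fin.mk_one, Fin.reduceFinMk, hd, e1, e2, e3, e4, e5, e6] <;>
      first | ring1 | linear_combination hpf | linear_combination -hpf
  have hji : A j i ≠ 0 := by
    rw [hs j i]
    simpa using hij.ne'
  refine ⟨A i j, fun k => A k j / A i j, fun k => A k i / A j i, i, j,
    ⟨hij, div_self hij.ne', by simp [hd], by simp [hd], div_self hji, fun k l => ?_⟩⟩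
  have h := hplu i j k l
  rw [hs j i]
  field_simp
  rw [hs k j, hs l i, hs k i, hs l j]
  linear_combination h

variable {a : ℝ} {α β : Fin 4 → ℝ} {i j : Fin 4}

theorem IsWedge.mulVec_apply (h : IsWedge A a α β i j) (x : Fin 4 → ℝ) (k : Fin 4) :
    (A *ᵥ x) k = a * (α k * (β ⬝ᵥ x) - β k * (α ⬝ᵥ x)) := by
  simp only [mulVec, dotProduct, h.apply_eq, Finset.mul_sum, ← Finset.sum_sub_distrib]
  exact Finset.sum_congr rfl fun l _ => by ring

theorem IsWedge.mulVec_fst (h : IsWedge A a α β i j) (x : Fin 4 → ℝ) :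
    (A *ᵥ x) i = a * (β ⬝ᵥ x) := by
  rw [h.mulVec_apply, h.left_fst, h.right_fst]
  ring

theorem IsWedge.mulVec_snd (h : IsWedge A a α β i j) (x : Fin 4 → ℝ) :
    (A *ᵥ x) j = -(a * (α ⬝ᵥ x)) := by
  rw [h.mulVec_apply, h.left_snd, h.right_snd]
  ring

theorem IsWedge.dotProduct_eq_zero (h : IsWedge A a α β i j) {q : Fin 4 → ℝ} (hq : A *ᵥ q = 0) :
    α ⬝ᵥ q = 0 ∧ β ⬝ᵥ q = 0 := by
  have h1 := h.mulVec_fst q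
  have h2 := h.mulVec_snd q
  rw [hq] at h1 h2
  have ha := h.pos.ne'
  simp_all

/-- The conserved quantities of the dynamics in logarithmic coordinates. -/
def invariants (α β : Fin 4 → ℝ) (i j : Fin 4) (y : Fin 4 → ℝ) (k : Fin 4) : ℝ :=
  y k - α k * y i - β k * y j

theorem sub_eq_of_invariants_eq {y c : Fin 4 → ℝ}
    (h : invariants α β i j y = invariants α β i j c) (k : Fin 4) :
    y k - c k = α k * (y i - c i) + β k * (y j - c j) := by
  have := congrFun h k
  simp only [invariants] at this
  linarith

theorem IsWedge.invariants_eq (h : IsWedge A a α β i j) {y : ℝ → Fin 4 → ℝ}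
    (hy : IsLogOrbit A y) (t : ℝ) :
    invariants α β i j (y t) = invariants α β i j (y 0) := by
  funext k
  have hc (l : Fin 4) (t : ℝ) := hasDerivAt_pi.1 (hy.hasDerivAt t) l
  have hd (t : ℝ) : HasDerivAt (fun t => invariants α β i j (y t) k) 0 t := by
    have := ((hc k t).sub ((hc i t).const_mul (α k))).sub ((hc j t).const_mul (β k))
    convert! this using 1
    rw [h.mulVec_apply _ k, h.mulVec_fst, h.mulVec_snd]
    ring
  exact is_const_of_deriv_eq_zero (fun t => (hd t).differentiableAt) (fun t => (hd t).deriv) t 0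

/-- Since α and β annihilate q, Σ q_k y_k depends on the invariants alone; this is what bounds each
y_k from below. -/
theorem IsWedge.sum_mul_invariants (h : IsWedge A a α β i j) {q : Fin 4 → ℝ} (hq : A *ᵥ q = 0)
    (y : Fin 4 → ℝ) : ∑ k, q k * invariants α β i j y k = ∑ k, q k * y k := by
  obtain ⟨h1, h2⟩ := h.dotProduct_eq_zero hq
  have : ∑ k, q k * invariants α β i j y k =
      ∑ k, q k * y k - (α ⬝ᵥ q) * y i - (β ⬝ᵥ q) * y j := by
    simp only [dotProduct, invariants, Finset.sum_mul, ← Finset.sum_sub_distrib]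
    exact Finset.sum_congr rfl fun k _ => by ring
  rw [this, h1, h2]
  ring

theorem sum_mul_le_of_nonpos {q y : Fin 4 → ℝ} (hq : ∀ i, 0 < q i) (hy : ∀ i, y i ≤ 0)
    (k : Fin 4) : ∑ l, q l * y l ≤ q k * y k := by
  have := Finset.single_le_sum (f := fun l => -(q l * y l))
    (fun l _ => neg_nonneg.2 (mul_nonpos_of_nonneg_of_nonpos (hq l).le (hy l)))
    (Finset.mem_univ k)
  rw [Finset.sum_neg_distrib] at this
  linarith

/-! ### Convex level curves and recurrence -/

theorem exists_sum_exp_lt_one {y γ : Fin 4 → ℝ} (hy : ∑ k, Real.exp (y k) = 1)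
    (hγ : γ ⬝ᵥ (fun k => Real.exp (y k)) ≠ 0) :
    ∃ s : ℝ, ∑ k, Real.exp (y k + s * γ k) < 1 := by
  by_contra! hle
  have hd : HasDerivAt (fun s : ℝ => ∑ k, Real.exp (y k + s * γ k))
      (∑ k, Real.exp (y k + 0 * γ k) * (1 * γ k)) 0 :=
    HasDerivAt.fun_sum fun k _ =>
      (((hasDerivAt_id (0 : ℝ)).mul_const (γ k)).const_add (y k)).exp
  have hmin : IsLocalMin (fun s : ℝ => ∑ k, Real.exp (y k + s * γ k)) 0 :=
    Eventually.of_forall fun s => by simpa [hy] using hle s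
  apply hγ
  rw [← hmin.hasDerivAt_eq_zero hd]
  exact Finset.sum_congr rfl fun k _ => by simp [mul_comm]

/-- The leaf of the invariants through a point that is not an equilibrium contains a point below the
unit energy level. -/
theorem IsWedge.exists_center (h : IsWedge A a α β i j) {y : Fin 4 → ℝ}
    (hy : ∑ k, Real.exp (y k) = 1) (hne : A *ᵥ (fun k => Real.exp (y k)) ≠ 0) :
    ∃ c, invariants α β i j y = invariants α β i j c ∧ ∑ k, Real.exp (c k) < 1 := by
  -- Moving along α or β preserves the invariants; off equilibria the energy has nonzero slope in
  -- one of these directions.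
  by_cases hα : α ⬝ᵥ (fun k => Real.exp (y k)) = 0
  · have hβ : β ⬝ᵥ (fun k => Real.exp (y k)) ≠ 0 := fun hβ =>
      hne (funext fun k => by simp [h.mulVec_apply, hα, hβ])
    obtain ⟨s, hs⟩ := exists_sum_exp_lt_one hy hβ
    refine ⟨fun k => y k + s * β k, funext fun k => ?_, hs⟩
    simp only [invariants, h.right_fst, h.right_snd]
    ring
  · obtain ⟨s, hs⟩ := exists_sum_exp_lt_one hy hα
    refine ⟨fun k => y k + s * α k, funext fun k => ?_, hs⟩
    simp only [invariants, h.left_fst, h.left_snd]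
    ring

/-- A ray from a point below the unit energy level meets the unit level at most once. -/
theorem one_le_of_sum_exp_eq_one {c u w : Fin 4 → ℝ} (hc : ∑ k, Real.exp (c k) < 1)
    (hu : ∑ k, Real.exp (u k) = 1) (hw : ∑ k, Real.exp (w k) = 1) {r : ℝ} (hr : 0 < r)
    (h : ∀ k, u k - c k = r * (w k - c k)) : 1 ≤ r := by
  by_contra! hr1
  have hk (k : Fin 4) : Real.exp (u k) ≤ (1 - r) * Real.exp (c k) + r * Real.exp (w k) := by
    have := convexOn_exp.2 (mem_univ (c k)) (mem_univ (w k)) (sub_nonneg.2 hr1.le) hr.le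
      (sub_add_cancel 1 r)
    simp only [smul_eq_mul] at this
    rwa [show (1 - r) * c k + r * w k = u k by linarith [h k]] at this
  have := Finset.sum_le_sum fun k (_ : k ∈ Finset.univ) => hk k
  rw [Finset.sum_add_distrib, ← Finset.mul_sum, ← Finset.mul_sum, hu, hw] at this
  nlinarith

/-- A nonstationary orbit passes, at positive times, through every point of its level set. -/
theorem IsWedge.exists_eq_of_invariants_eq (h : IsWedge A a α β i j) {q : Fin 4 → ℝ}
    (hq : ∀ i, 0 < q i) (hAq : A *ᵥ q = 0) {y : ℝ → Fin 4 → ℝ} (hy : IsLogOrbit A y)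
    (hne : A *ᵥ (fun k => Real.exp (y 0 k)) ≠ 0) {w : Fin 4 → ℝ}
    (hw : ∑ k, Real.exp (w k) = 1)
    (hwy : invariants α β i j w = invariants α β i j (y 0)) : ∃ t > 0, y t = w := by
  obtain ⟨c, hc, hc1⟩ := h.exists_center (hy.sum_exp 0) hne
  have hyc (t : ℝ) := sub_eq_of_invariants_eq ((h.invariants_eq hy t).trans hc)
  have hwc := sub_eq_of_invariants_eq (hwy.trans hc)
  have hbd (k : Fin 4) : ∃ M, ∀ t, |y t k - c k| ≤ M := by
    refine ⟨max |0 - c k| |(∑ l, q l * y 0 l) / q k - c k|, fun t => ?_⟩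
    have hle (l : Fin 4) : y t l ≤ 0 := (neg_of_sum_exp_eq_one (hy.sum_exp t) l).le
    have hlow : (∑ l, q l * y 0 l) / q k ≤ y t k := by
      rw [div_le_iff₀' (hq k), ← h.sum_mul_invariants hAq, ← h.invariants_eq hy t,
        h.sum_mul_invariants hAq]
      exact sum_mul_le_of_nonpos hq hle k
    rw [max_comm]
    exact abs_le_max_abs_abs (by linarith) (by linarith [hle k])
  obtain ⟨M₁, hM₁⟩ := hbd i
  obtain ⟨M₂, hM₂⟩ := hbd j
  let z : ℝ → ℂ := fun t => ⟨y t i - c i, y t j - c j⟩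
  let v : ℝ → ℂ := fun t =>
    ⟨(A *ᵥ fun k => Real.exp (y t k)) i, (A *ᵥ fun k => Real.exp (y t k)) j⟩
  have hcomp (t : ℝ) (k : Fin 4) := hasDerivAt_pi.1 (hy.hasDerivAt t) k
  have hycont : Continuous y := continuous_iff_continuousAt.2 fun t => (hy.hasDerivAt t).continuousAt
  have hz (t : ℝ) : HasDerivAt z (v t) t :=
    Complex.equivRealProdCLM.symm.hasFDerivAt.comp_hasDerivAt t
      (((hcomp t i).sub_const (c i)).prodMk ((hcomp t j).sub_const (c j)))
  have hv : Continuous v := by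
    have hAc : Continuous fun t => A *ᵥ fun k => Real.exp (y t k) := by fun_prop
    exact Complex.equivRealProdCLM.symm.continuous.comp
      (((continuous_apply i).comp hAc).prodMk ((continuous_apply j).comp hAc))
  have hz0 (t : ℝ) : z t ≠ 0 := by
    intro h0
    have h1 : y t i - c i = 0 := congrArg Complex.re h0
    have h2 : y t j - c j = 0 := congrArg Complex.im h0
    have hEq : y t = c := funext fun k => by
      have := hyc t k
      rw [h1, h2] at this
      linarith
    rw [← hEq, hy.sum_exp t] at hc1
    exact lt_irrefl _ hc1
  set m := ∑ k, Real.exp (c k) with hm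
  -- The tangent-plane inequality for the convex energy between y t and c. In the coordinates (y_i,
  -- y_j) of the leaf, the gradient is (α·x, β·x) with x = exp(y t).
  have hgrad (t : ℝ) : 1 - m ≤ (y t i - c i) * (α ⬝ᵥ fun k => Real.exp (y t k)) +
      (y t j - c j) * (β ⬝ᵥ fun k => Real.exp (y t k)) := by
    simp only [dotProduct]
    rw [Finset.mul_sum, Finset.mul_sum, ← Finset.sum_add_distrib, ← hy.sum_exp t, hm,
      ← Finset.sum_sub_distrib]
    refine Finset.sum_le_sum fun k _ => ?_
    have h1 := Real.add_one_le_exp (c k - y t k)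
    have h2 : Real.exp (c k) = Real.exp (y t k) * Real.exp (c k - y t k) := by
      rw [← Real.exp_add]; ring_nf
    have h3 := Real.exp_pos (y t k)
    have h4 := hyc t k
    nlinarith
  have hnorm (t : ℝ) : Complex.normSq (z t) ≤ M₁ ^ 2 + M₂ ^ 2 := by
    have h1 := sq_le_sq' (abs_le.1 (hM₁ t)).1 (abs_le.1 (hM₁ t)).2
    have h2 := sq_le_sq' (abs_le.1 (hM₂ t)).1 (abs_le.1 (hM₂ t)).2
    simp only [Complex.normSq_apply, z]
    linarith
  have hpos (t : ℝ) : 0 < Complex.normSq (z t) := Complex.normSq_pos.2 (hz0 t)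
  have hκ : 0 < a * (1 - m) := mul_pos h.pos (by linarith)
  -- The velocity is a(β·x, -α·x), the gradient rotated by a quarter turn, so `hgrad` bounds the
  -- angular velocity.
  have him (t : ℝ) : (v t / z t).im ≤ -(a * (1 - m) / (M₁ ^ 2 + M₂ ^ 2)) := by
    rw [Complex.div_im, ← sub_div]
    have hnum : (v t).im * (z t).re - (v t).re * (z t).im ≤ -(a * (1 - m)) := by
      simp only [v, z, h.mulVec_fst, h.mulVec_snd]
      have := mul_le_mul_of_nonneg_left (hgrad t) h.pos.le
      linarith
    calc _ ≤ -(a * (1 - m)) / Complex.normSq (z t) := by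
          have := hpos t
          gcongr
      _ ≤ _ := by
          rw [neg_div, neg_le_neg_iff]
          exact div_le_div_of_nonneg_left hκ.le (hpos t) (hnorm t)
  let ζ : ℂ := ⟨w i - c i, w j - c j⟩
  have hζ : ζ ≠ 0 := by
    intro h0
    have h1 : w i - c i = 0 := congrArg Complex.re h0
    have h2 : w j - c j = 0 := congrArg Complex.im h0
    have hEq : w = c := funext fun k => by
      have := hwc k
      rw [h1, h2] at this
      linarith
    rw [← hEq, hw] at hm
    linarith
  obtain ⟨t, ht, r, hr, hrz⟩ := exists_pos_smul_eq_of_im_div_le hz hv hz0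
    (div_pos hκ ((hpos 0).trans_le (hnorm 0))) him hζ
  have hre : w i - c i = r * (y t i - c i) := by simpa [ζ, z] using congrArg Complex.re hrz
  have hie : w j - c j = r * (y t j - c j) := by simpa [ζ, z] using congrArg Complex.im hrz
  have hk (k : Fin 4) : w k - c k = r * (y t k - c k) := by
    rw [hwc k, hyc t k, hre, hie]
    ring
  have hr1 : r = 1 := by
    refine le_antisymm ?_ (one_le_of_sum_exp_eq_one hc1 hw (hy.sum_exp t) hr hk)
    have := one_le_of_sum_exp_eq_one hc1 (hy.sum_exp t) hw (inv_pos.2 hr) fun k => by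
      rw [hk k, inv_mul_cancel_left₀ hr.ne']
    exact (one_le_inv₀ hr).1 this
  refine ⟨t, ht, funext fun k => ?_⟩
  have := hk k
  rw [hr1] at this
  linarith

/-! ### Lyapunov stability -/

theorem continuous_ofLog : Continuous ofLog := by
  unfold ofLog
  fun_prop

/-- A level set of the invariants is Lyapunov stable. -/
theorem IsWedge.isLyapunovStable (h : IsWedge A a α β i j) (hskew : A.transpose = -A)
    {q : Fin 4 → ℝ} (hq : ∀ i, 0 < q i) (hAq : A *ᵥ q = 0) {η : Fin 4 → ℝ}
    {γ : Set (EuclideanSpace ℝ (Fin 4))}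
    (hγ : γ = ofLog '' {w | ∑ k, Real.exp (w k) = 1 ∧ invariants α β i j w = η}) :
    IsLyapunovStable A γ := by
  intro ε hε
  let N : (Fin 4 → ℝ) → ℝ := fun w => ∑ k, |invariants α β i j w k - η k|
  have hNc : Continuous N := by
    simp only [N, invariants]
    fun_prop
  have hN0 (w : Fin 4 → ℝ) (hw : invariants α β i j w = η) : N w = 0 := by simp [N, hw]
  have hinfc : Continuous fun w => Metric.infDist (ofLog w) γ :=
    (Metric.continuous_infDist_pt γ).comp continuous_ofLog
  obtain ⟨δ, hδ, hδε⟩ : ∃ δ > 0, ∀ w : Fin 4 → ℝ, ∑ k, Real.exp (w k) = 1 → N w < δ →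
      Metric.infDist (ofLog w) γ < ε := by
    set M := ∑ k, q k * (|η k| + 1) with hM
    -- Points with N ≤ 1 lie in this box, so those at distance at least ε from γ lie in a compact
    -- set, on which N has a positive minimum.
    let C : Set (Fin 4 → ℝ) := Icc (fun k => -M / q k) (fun _ => 0) ∩
      ({w | ∑ k, Real.exp (w k) = 1} ∩ {w | ε ≤ Metric.infDist (ofLog w) γ})
    have hC : IsCompact C := isCompact_Icc.inter_right
      ((isClosed_eq (by fun_prop) continuous_const).inter (isClosed_le continuous_const hinfc))
    have hmemC (w : Fin 4 → ℝ) (hw : ∑ k, Real.exp (w k) = 1) (hw1 : N w ≤ 1)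
        (hwε : ε ≤ Metric.infDist (ofLog w) γ) : w ∈ C := by
      have hneg (k : Fin 4) : w k ≤ 0 := (neg_of_sum_exp_eq_one hw k).le
      refine ⟨⟨fun k => ?_, hneg⟩, hw, hwε⟩
      rw [div_le_iff₀' (hq k)]
      refine le_trans ?_ (sum_mul_le_of_nonpos hq hneg k)
      rw [← h.sum_mul_invariants hAq, hM, ← Finset.sum_neg_distrib]
      refine Finset.sum_le_sum fun l _ => ?_
      rw [← mul_neg]
      refine mul_le_mul_of_nonneg_left ?_ (hq l).le
      have h1 : |invariants α β i j w l - η l| ≤ 1 :=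
        (Finset.single_le_sum (f := fun k => |invariants α β i j w k - η k|)
          (fun _ _ => abs_nonneg _) (Finset.mem_univ l)).trans hw1
      linarith [(abs_le.1 h1).1, neg_abs_le (η l)]
    rcases C.eq_empty_or_nonempty with hem | hne
    · refine ⟨1, one_pos, fun w hw hw1 => ?_⟩
      by_contra! hge
      have := hmemC w hw hw1.le hge
      simp [hem] at this
    · obtain ⟨w₀, hw₀, hmin⟩ := hC.exists_isMinOn hne hNc.continuousOn
      have hpos : 0 < N w₀ := by
        refine lt_of_le_of_ne (Finset.sum_nonneg fun _ _ => abs_nonneg _) fun h0 => ?_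
        have hz := (Finset.sum_eq_zero_iff_of_nonneg fun k _ => abs_nonneg _).1 h0.symm
        have hmem : ofLog w₀ ∈ γ := by
          rw [hγ]
          exact ⟨w₀, ⟨hw₀.2.1, funext fun k =>
            sub_eq_zero.1 (abs_eq_zero.1 (hz k (Finset.mem_univ k)))⟩, rfl⟩
        have := hw₀.2.2
        rw [mem_ofPred_eq, Metric.infDist_zero_of_mem hmem] at this
        linarith
      refine ⟨min 1 (N w₀), lt_min one_pos hpos, fun w hw hw1 => ?_⟩
      by_contra! hge
      have := isMinOn_iff.1 hmin w (hmemC w hw (hw1.le.trans (min_le_left _ _)) hge)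
      exact absurd (hw1.trans_le (min_le_right _ _)) (not_lt.2 this)
  let V : Set (EuclideanSpace ℝ (Fin 4)) := {x | ∀ k, 0 < x k}
  let lg : EuclideanSpace ℝ (Fin 4) → Fin 4 → ℝ := fun x k => Real.log (x k)
  have hlg (w : Fin 4 → ℝ) : lg (ofLog w) = w := funext fun k => Real.log_exp (w k)
  have hV : IsOpen V := by
    simp only [V, ofPred_forall]
    exact isOpen_iInter_of_finite fun k => isOpen_lt continuous_const (by fun_prop)
  have hlgc : ContinuousOn lg V := continuousOn_pi.2 fun k =>
    ContinuousOn.log (by fun_prop) fun x hx => (hx k).ne'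
  refine ⟨V ∩ (fun x => N (lg x)) ⁻¹' Iio δ,
    (hNc.comp_continuousOn hlgc).isOpen_inter_preimage hV isOpen_Iio, ?_, ?_⟩
  · rw [hγ]
    rintro _ ⟨w, ⟨-, hw⟩, rfl⟩
    refine ⟨fun k => Real.exp_pos _, ?_⟩
    rw [mem_preimage, hlg, hN0 w hw]
    exact hδ
  · rintro x hx ⟨⟨-, hxδ⟩, hxs⟩ t ht
    obtain ⟨w, hwx, hw1⟩ := exists_ofLog_eq hxs
    obtain ⟨y, hy0, hy⟩ := exists_isLogOrbit hskew hw1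
    rw [hy.eq_of_isForwardTrajectory hx (by rw [hy0, hwx]) ht]
    refine hδε _ (hy.sum_exp t) ?_
    rw [mem_preimage, ← hwx, hlg] at hxδ
    have : N (y t) = N w := by simp only [N, h.invariants_eq hy t, hy0]
    rw [this]
    exact hxδ

end Replicator

/-! ### Periodicity and stability combined -/

theorem mainTheorem3 (A : Matrix (Fin 4) (Fin 4) ℝ) (hskew : A.transpose = -A)
    (hperm : Replicator.IsPermanent A) :
    ∀ p ∈ Replicator.intSimplex \ Replicator.interiorEquilibria A,
      (∃ γ : Set (EuclideanSpace ℝ (Fin 4)), Replicator.IsPeriodicOrbit A γ ∧ p ∈ γ) ∧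
      (∀ γ : Set (EuclideanSpace ℝ (Fin 4)), Replicator.IsPeriodicOrbit A γ → p ∈ γ →
        Replicator.IsLyapunovStable A γ) := by
  rintro p ⟨hp, hpK⟩
  obtain ⟨q, hq, hAq⟩ := hperm.exists_pos_kernel hskew
  obtain ⟨y₀, rfl, hy₀⟩ := Replicator.exists_ofLog_eq hp
  obtain ⟨y, rfl, hy⟩ := Replicator.exists_isLogOrbit hskew hy₀
  have hne : A.mulVec (fun k => Real.exp (y 0 k)) ≠ 0 := fun h => hpK ⟨h, hp⟩
  have hA : A ≠ 0 := fun h => hne (by rw [h, Matrix.zero_mulVec])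
  obtain ⟨a, α, β, i, j, hW⟩ := Replicator.exists_isWedge hskew hq hAq hA
  have hlevel {w : Fin 4 → ℝ} (hw : ∑ k, Real.exp (w k) = 1)
      (hwy : Replicator.invariants α β i j w = Replicator.invariants α β i j (y 0)) :
      ∃ t > 0, y t = w := hW.exists_eq_of_invariants_eq hq hAq hy hne hw hwy
  refine ⟨?_, ?_⟩
  -- The starting point lies on its own level set, so it is reached again at a positive time.
  · obtain ⟨T, hT, hyT⟩ := hlevel hy₀ rfl
    refine ⟨_, ⟨fun t => Replicator.ofLog (y t), T, hy.isIntegralCurve, hT, fun t => ?_, ?_, rfl⟩,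
      0, rfl⟩
    · exact congrArg Replicator.ofLog (hy.periodic hyT t)
    · by_contra! hconst
      refine hne ?_
      have hyc : y = fun _ => y 0 := funext fun t => funext fun k =>
        Real.exp_injective (congrArg (fun x : EuclideanSpace ℝ (Fin 4) => x k) (hconst t 0))
      have h0 := hy.hasDerivAt 0
      have h1 : HasDerivAt y 0 0 := by
        rw [hyc]
        exact hasDerivAt_const _ _
      exact h0.unique h1
  · rintro γ ⟨x, T, hx, hT, hper, -, rfl⟩ ⟨s, hs⟩
    refine hW.isLyapunovStable hskew hq hAq (η := Replicator.invariants α β i j (y 0)) ?_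
    have hfwd (t : ℝ) (ht : 0 ≤ t) : x (t + s) = Replicator.ofLog (y t) := by
      refine hy.eq_of_isForwardTrajectory (x := fun t => x (t + s)) ?_ (by simpa using hs) ht
      exact (hx.comp_add s).isIntegralCurveOn _
    ext b
    constructor
    · rintro ⟨t, rfl⟩
      -- `hfwd` identifies x only after time s; adding enough periods moves t past s.
      obtain ⟨n, hn⟩ := Archimedean.arch (s - t) hT
      have h0 : 0 ≤ t + n • T - s := by linarith
      refine ⟨y (t + n • T - s), ⟨hy.sum_exp _, hW.invariants_eq hy _⟩, ?_⟩
      rw [← hfwd _ h0, sub_add_cancel]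
      exact hper.nsmul n t
    · rintro ⟨w, ⟨hw1, hwy⟩, rfl⟩
      obtain ⟨t, ht, rfl⟩ := hlevel hw1 hwy
      exact ⟨t + s, hfwd t ht.le⟩
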